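/- Let $N\in\mathbb N$. Let $e_1,\dots,e_m\in\mathbb Z^N$ span $\mathbb R^N$, put $\mathcal E=\{\pm e_1,\dots,\pm e_m\}$, and let $\beta:\mathbb Z^N\to[0,\infty)$ satisfy $\beta(-i)=\beta(i)$ for all $i$, and $\beta(i)>0$ if and only if $i\in\mathcal E$. Let $$\phi(v)=\sum_{i\in\mathcal E}\beta(i)\,|i\cdot v|\quad(v\in\mathbb R^N),\qquad \phi^\circ(x)=\sup\{x\cdot v:\ \phi(v)\le 1\}\quad(x\in\mathbb R^N)$$ be the associated norm and its polar norm. There exists a constant $C=C(\phi)>0$, depending only on $\phi$, with the following property. Let $\varepsilon>0$, $h>0$, and let $u:\varepsilon\mathbb Z^N\to\mathbb R$ be the solution of the rescaled discrete Rudin–Osher–Fatemi problem with datum $\phi^\circ$, that is, for some $z:\varepsilon\mathbb Z^N\times\varepsilon\mathbb Z^N\to\mathbb R$ and all $i,j\in\varepsilon\mathbb Z^N$, $$h\sum_{k\in\varepsilon\mathbb Z^N}\frac{z_{ik}-z_{ki}}{\varepsilon}+u_i=\phi^\circ(i),\qquad z_{ij}(u_i-u_j)=\beta\!\left(\tfrac{i-j}{\varepsilon}\right)|u_i-u_j|,\qquad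 |z_{ij}|\le\beta\!\left(\tfrac{i-j}{\varepsilon}\right).$$ Then $u_i\le\phi^h_i$ for every $i\in\varepsilon\mathbb Z^N$, where, with $a\vee b=\max\{a,b\}$, $$\phi^h_i:=\begin{cases}\phi^\circ(i)+\dfrac{Ch}{\phi^\circ(i)} & \text{if }\phi^\circ(i)\ge C(\sqrt h\vee\varepsilon),\\[2mm] C(\sqrt h\vee\varepsilon)+\dfrac{Ch}{\sqrt h\vee\varepsilon} & \text{otherwise.}\end{cases}$$ -/

import Mathlib

noncomputable section

namespace DiscreteROF

/-- The finite symmetric set `𝓔 = {± e₁, …, ± e_m} ⊆ ℤ^N`. -/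
def directions {N m : ℕ} (e : Fin m → Fin N → ℤ) : Finset (Fin N → ℤ) :=
  Finset.univ.image e ∪ Finset.univ.image (fun k => -e k)

/-- `β` is an interaction function on `ℤ^N` carried by the integer vectors `e₁, …, e_m`:
these vectors span `ℝ^N`, and `β` is non-negative, even, and positive exactly on `{± e_k}`. -/
structure IsInteraction {N m : ℕ} (e : Fin m → Fin N → ℤ) (β : (Fin N → ℤ) → ℝ) : Prop where
  span_eq_top : Submodule.span ℝ (Set.range fun k => fun a => ((e k a : ℤ) : ℝ)) = ⊤
  nonneg : ∀ i, 0 ≤ β i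
  even : ∀ i, β (-i) = β i
  pos_iff : ∀ i, 0 < β i ↔ i ∈ directions e

/-- The anisotropy `φ(v) = ∑_{i ∈ 𝓔} β(i) |i · v|` on `ℝ^N` associated with `β`. -/
def anisotropy {N m : ℕ} (e : Fin m → Fin N → ℤ) (β : (Fin N → ℤ) → ℝ)
    (v : Fin N → ℝ) : ℝ :=
  ∑ i ∈ directions e, β i * |(fun a => (i a : ℝ)) ⬝ᵥ v|

/-- The polar (dual) norm `φ°(x) = sup {x · v : φ(v) ≤ 1}`. -/
def polar {N : ℕ} (φ : (Fin N → ℝ) → ℝ) (x : Fin N → ℝ) : ℝ :=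
  sSup {t : ℝ | ∃ v : Fin N → ℝ, φ v ≤ 1 ∧ t = x ⬝ᵥ v}

/-- The point `ε k` of the lattice `ε ℤ^N`. Since `k ↦ ε k` is a bijection from `ℤ^N` onto
`ε ℤ^N` for `ε > 0`, functions on `ε ℤ^N` (and on pairs of points of `ε ℤ^N`) are written
below as functions of the indices `k ∈ ℤ^N`. -/
def latticePoint {N : ℕ} (ε : ℝ) (k : Fin N → ℤ) : Fin N → ℝ :=
  fun a => ε * (k a : ℝ)

/-- The discrete divergence `(D*_ε z)_i = ∑_j (z_{ij} - z_{ji}) / ε`. -/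
def divAdjoint {N : ℕ} (ε : ℝ) (z : (Fin N → ℤ) → (Fin N → ℤ) → ℝ) (i : Fin N → ℤ) : ℝ :=
  ∑' j : Fin N → ℤ, (z i j - z j i) / ε

/-- The pair `(u, z)` solves the rescaled discrete Rudin-Osher-Fatemi problem on `ε ℤ^N` with
time step `h`, interaction `β` and datum `g`. The coefficient `α^ε_{ij}` between the
lattice points of indices `i` and `j` is `β (i - j)`. -/
structure IsSolution {N : ℕ} (β : (Fin N → ℤ) → ℝ) (ε h : ℝ) (g u : (Fin N → ℤ) → ℝ)
    (z : (Fin N → ℤ) → (Fin N → ℤ) → ℝ) : Prop where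
  equation : ∀ i, h * divAdjoint ε z i + u i = g i
  calibrates : ∀ i j, z i j * (u i - u j) = β (i - j) * |u i - u j|
  bound : ∀ i j, |z i j| ≤ β (i - j)

/-- The barrier `φ^h` on `ε ℤ^N`, with constant `C`. -/
def barrier {N : ℕ} (φ : (Fin N → ℝ) → ℝ) (C ε h : ℝ) (i : Fin N → ℤ) : ℝ :=
  if C * max (Real.sqrt h) ε ≤ polar φ (latticePoint ε i) then
    polar φ (latticePoint ε i) + C * h / polar φ (latticePoint ε i)
  else
    C * max (Real.sqrt h) ε + C * h / max (Real.sqrt h) ε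

end DiscreteROF

end

namespace DiscreteROF

/-! The barrier is a supersolution, so the bound is a comparison principle. Truncate the polar norm
from below at `√(A h)` to get `f`; since `t + A h / t` increases for `t ≥ √(A h)`, the function `f +
A h / f` has the same ordering as `f`, and any field calibrating `f` calibrates it too. It is a
supersolution as soon as that field has divergence at least `-A / f`.

The field is built line by line (`exists_flux`). On a lattice line of direction `k`, `f` is
quasiconvex, and the flux equals `-1` before the set of minimizers, `+1` after it, and is
interpolated linearly across it. Its increment is thus about the inverse of the number of
minimizers. The balls of the polar norm are zonotopes, Minkowski sums of the segments `β j • [-j,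
j]`, so every nonempty section of a ball of radius `r` in a direction `j` has length at least `2 r β
j` in units of `j` (`exists_section`). Hence the plateau has at least order `f / ε` points, which
gives the divergence bound.

The constant must depend on `φ` and not on the interaction producing it. A reference interaction
with the same `φ` is fixed: every nonzero direction of another one is parallel to a reference
direction (`exists_parallel`), and the weighted sum of the lengths of its directions is a function
of `φ` (`sum_mul_norm_eq`). -/

/-- An integer vector, viewed in `ℝ^N`. -/
def realVec {N : ℕ} (k : Fin N → ℤ) : Fin N → ℝ := fun a => (k a : ℝ)

/-! ### Polar norm of a zonotopal anisotropy: duality, finiteness and sections of balls. -/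

section Anisotropy

variable {N m : ℕ} {e : Fin m → Fin N → ℤ} {β : (Fin N → ℤ) → ℝ}

lemma anisotropy_eq (v : Fin N → ℝ) :
    anisotropy e β v = ∑ i ∈ directions e, β i * |realVec i ⬝ᵥ v| := rfl

lemma realVec_neg (k : Fin N → ℤ) : realVec (-k) = -realVec k := by
  ext a; simp [realVec]

lemma realVec_ne_zero {k : Fin N → ℤ} (hk : k ≠ 0) : realVec k ≠ 0 := by
  intro h
  apply hk
  ext a
  have := congrFun h a
  simpa [realVec] using this

lemma realVec_dot_self_pos {k : Fin N → ℤ} (hk : k ≠ 0) : 0 < realVec k ⬝ᵥ realVec k :=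
  lt_of_le_of_ne (Finset.sum_nonneg fun a _ => mul_self_nonneg (realVec k a))
    fun h => realVec_ne_zero hk (dotProduct_self_eq_zero.1 h.symm)

lemma neg_mem_directions {k : Fin N → ℤ} (hk : k ∈ directions e) : -k ∈ directions e := by
  simp only [directions, Finset.mem_union, Finset.mem_image, Finset.mem_univ, true_and] at hk ⊢
  rcases hk with ⟨a, rfl⟩ | ⟨a, rfl⟩
  · exact Or.inr ⟨a, rfl⟩
  · exact Or.inl ⟨a, by simp⟩

lemma IsInteraction.eq_zero (h : IsInteraction e β) {k : Fin N → ℤ} (hk : k ∉ directions e) :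
    β k = 0 :=
  le_antisymm (not_lt.1 fun hp => hk ((h.pos_iff k).1 hp)) (h.nonneg k)

lemma IsInteraction.anisotropy_nonneg (h : IsInteraction e β) (v : Fin N → ℝ) :
    0 ≤ anisotropy e β v :=
  Finset.sum_nonneg fun i _ => mul_nonneg (h.nonneg i) (abs_nonneg _)

lemma anisotropy_smul (c : ℝ) (v : Fin N → ℝ) :
    anisotropy e β (c • v) = |c| * anisotropy e β v := by
  simp only [anisotropy_eq, dotProduct_smul, smul_eq_mul, abs_mul, Finset.mul_sum]
  exact Finset.sum_congr rfl fun i _ => by ring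

lemma IsInteraction.mul_abs_le_anisotropy (h : IsInteraction e β) {k : Fin N → ℤ}
    (hk : k ∈ directions e) (v : Fin N → ℝ) :
    β k * |realVec k ⬝ᵥ v| ≤ anisotropy e β v :=
  Finset.single_le_sum (f := fun i => β i * |realVec i ⬝ᵥ v|)
    (fun i _ => mul_nonneg (h.nonneg i) (abs_nonneg _)) hk

/-- Every linear functional is dominated by a multiple of the anisotropy. -/
lemma IsInteraction.exists_dot_le (h : IsInteraction e β) (x : Fin N → ℝ) :
    ∃ B : ℝ, 0 ≤ B ∧ ∀ v, |x ⬝ᵥ v| ≤ B * anisotropy e β v := by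
  have hx : x ∈ Submodule.span ℝ (Set.range fun k => fun a => ((e k a : ℤ) : ℝ)) := by
    rw [h.span_eq_top]; trivial
  induction hx using Submodule.span_induction with
  | mem x hx =>
    obtain ⟨k, rfl⟩ := hx
    have hk : e k ∈ directions e :=
      Finset.mem_union_left _ (Finset.mem_image_of_mem _ (Finset.mem_univ k))
    have hp := (h.pos_iff _).2 hk
    refine ⟨(β (e k))⁻¹, by positivity, fun v => ?_⟩
    have := h.mul_abs_le_anisotropy hk v
    rw [inv_mul_eq_div, le_div_iff₀ hp, mul_comm]
    exact this
  | zero => exact ⟨0, le_rfl, fun v => by simp⟩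
  | add x y _ _ hx hy =>
    obtain ⟨B, hB, hx⟩ := hx
    obtain ⟨B', hB', hy⟩ := hy
    refine ⟨B + B', by positivity, fun v => ?_⟩
    rw [add_dotProduct, add_mul]
    exact (abs_add_le _ _).trans (add_le_add (hx v) (hy v))
  | smul c x _ hx =>
    obtain ⟨B, hB, hx⟩ := hx
    refine ⟨|c| * B, by positivity, fun v => ?_⟩
    rw [smul_dotProduct, smul_eq_mul, abs_mul, mul_assoc]
    exact mul_le_mul_of_nonneg_left (hx v) (abs_nonneg c)

lemma IsInteraction.bddAbove (h : IsInteraction e β) (x : Fin N → ℝ) :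
    BddAbove {t : ℝ | ∃ v : Fin N → ℝ, anisotropy e β v ≤ 1 ∧ t = x ⬝ᵥ v} := by
  obtain ⟨B, hB, hx⟩ := h.exists_dot_le x
  refine ⟨B, ?_⟩
  rintro _ ⟨v, hv, rfl⟩
  exact (le_abs_self _).trans ((hx v).trans (mul_le_of_le_one_right hB hv))

lemma IsInteraction.dot_le_polar_mul (h : IsInteraction e β) (x v : Fin N → ℝ) :
    x ⬝ᵥ v ≤ polar (anisotropy e β) x * anisotropy e β v := by
  rcases (h.anisotropy_nonneg v).eq_or_lt with hv | hv
  · obtain ⟨B, hB, hx⟩ := h.exists_dot_le x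
    have := hx v
    rw [← hv, mul_zero] at this ⊢
    exact (le_abs_self _).trans this
  · have : (anisotropy e β v)⁻¹ * (x ⬝ᵥ v) ≤ polar (anisotropy e β) x := by
      refine le_csSup (h.bddAbove x) ⟨(anisotropy e β v)⁻¹ • v, ?_, by simp⟩
      rw [anisotropy_smul, abs_of_pos (inv_pos.2 hv), inv_mul_cancel₀ hv.ne']
    rwa [inv_mul_le_iff₀ hv, mul_comm] at this

/-- Presents the ball of radius `c` as an intersection of half-spaces; all convexity arguments on
balls go through this form. -/
lemma IsInteraction.polar_le_iff (h : IsInteraction e β) {x : Fin N → ℝ} {c : ℝ} (hc : 0 ≤ c) :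
    polar (anisotropy e β) x ≤ c ↔ ∀ v, x ⬝ᵥ v ≤ c * anisotropy e β v := by
  constructor
  · intro hx v
    exact (h.dot_le_polar_mul x v).trans
      (mul_le_mul_of_nonneg_right hx (h.anisotropy_nonneg v))
  · intro hx
    refine csSup_le ⟨0, 0, by simp [anisotropy_eq], by simp⟩ ?_
    rintro _ ⟨v, hv, rfl⟩
    exact (hx v).trans (mul_le_of_le_one_right hc hv)

/-- Sublevel sets of the polar norm are convex along lines. -/
lemma IsInteraction.polar_line_le (h : IsInteraction e β) {x d : Fin N → ℝ} {c r s t : ℝ}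
    (hc : 0 ≤ c) (hr : polar (anisotropy e β) (x + r • d) ≤ c)
    (ht : polar (anisotropy e β) (x + t • d) ≤ c) (hrs : r ≤ s) (hst : s ≤ t) :
    polar (anisotropy e β) (x + s • d) ≤ c := by
  rw [h.polar_le_iff hc] at hr ht ⊢
  intro v
  have h1 := hr v
  have h2 := ht v
  simp only [add_dotProduct, smul_dotProduct, smul_eq_mul] at h1 h2 ⊢
  rcases le_total 0 (d ⬝ᵥ v) with hd | hd
  · nlinarith
  · nlinarith

lemma IsInteraction.abs_apply_le (h : IsInteraction e β) (x : Fin N → ℝ) (a : Fin N) :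
    |x a| ≤ polar (anisotropy e β) x * anisotropy e β (Pi.single a 1) := by
  have h1 := h.dot_le_polar_mul x (Pi.single a 1)
  have h2 := h.dot_le_polar_mul x ((-1 : ℝ) • Pi.single a 1)
  rw [anisotropy_smul, dotProduct_smul] at h2
  simp only [dotProduct_single, mul_one, smul_eq_mul, abs_neg, abs_one, one_mul] at h1 h2
  exact abs_le.2 ⟨by linarith, h1⟩

/-- Coercivity on the lattice: it makes minimizers along lines exist and the contact set in the
comparison argument finite. -/
lemma IsInteraction.finite_sublevel (h : IsInteraction e β) {ε : ℝ} (hε : 0 < ε) (c : ℝ) :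
    {i : Fin N → ℤ | polar (anisotropy e β) (latticePoint ε i) ≤ c}.Finite := by
  let b : Fin N → ℤ := fun a => ⌈c * anisotropy e β (Pi.single a 1) / ε⌉
  refine (Set.finite_Icc (-b) b).subset fun i hi => ?_
  have key : ∀ a, |(i a : ℝ)| ≤ (b a : ℝ) := by
    intro a
    refine le_trans ?_ (Int.le_ceil _)
    rw [le_div_iff₀ hε]
    have := (h.abs_apply_le (latticePoint ε i) a).trans
      (mul_le_mul_of_nonneg_right hi (h.anisotropy_nonneg _))
    rw [latticePoint, abs_mul, abs_of_pos hε] at this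
    linarith
  refine ⟨fun a => ?_, fun a => ?_⟩
  · have := (abs_le.1 (key a)).1
    exact_mod_cast this
  · have := (abs_le.1 (key a)).2
    exact_mod_cast this

/-- Every nonempty section of a ball of the polar norm in an interaction direction `j` contains
a segment whose length is comparable to the radius. -/
lemma IsInteraction.exists_section (h : IsInteraction e β) {j : Fin N → ℤ}
    (hj : j ∈ directions e) (hj0 : j ≠ 0) {x : Fin N → ℝ} {c : ℝ} (hc : 0 ≤ c)
    (hx : polar (anisotropy e β) x ≤ c) :
    ∃ t : ℝ, ∀ s : ℝ, |s| ≤ c * β j →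
      polar (anisotropy e β) (x + (t + s) • realVec j) ≤ c := by
  classical
  rw [h.polar_le_iff hc] at hx
  let rest : (Fin N → ℝ) → ℝ := fun v =>
    ∑ i ∈ (directions e).erase j, β i * |realVec i ⬝ᵥ v|
  have hsplit : ∀ v, anisotropy e β v = rest v + β j * |realVec j ⬝ᵥ v| := fun v => by
    rw [anisotropy_eq, ← Finset.sum_erase_add _ _ hj]
  have hadd : ∀ v w, rest (v + w) ≤ rest v + rest w := fun v w => by
    simp only [rest]
    rw [← Finset.sum_add_distrib]
    refine Finset.sum_le_sum fun i _ => ?_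
    rw [← mul_add, dotProduct_add]
    exact mul_le_mul_of_nonneg_left (abs_add_le _ _) (h.nonneg i)
  have hsmul : ∀ (a : ℝ) v, rest (a • v) = |a| * rest v := fun a v => by
    simp only [rest, dotProduct_smul, smul_eq_mul, abs_mul, Finset.mul_sum]
    exact Finset.sum_congr rfl fun i _ => by ring
  -- By duality, `x + t • realVec j` lies in `c` times the zonotope without the `j` segment exactly
  -- when `t * (realVec j ⬝ᵥ v) ≤ q v` for all `v`. Such a `t` comes from a Hahn–Banach argument:
  -- `q` is sublinear and nonnegative on the hyperplane orthogonal to `j`. Adding back the `j`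
  -- segment then leaves room for `|s| ≤ c * β j`.
  let q : (Fin N → ℝ) → ℝ := fun v => c * rest v - x ⬝ᵥ v
  have hq0 : ∀ v, realVec j ⬝ᵥ v = 0 → 0 ≤ q v := fun v hv => by
    have := hx v
    rw [hsplit, hv] at this
    simp only [q]
    simp only [abs_zero, mul_zero, add_zero] at this
    linarith
  have hqadd : ∀ v w, q (v + w) ≤ q v + q w := fun v w => by
    have := mul_le_mul_of_nonneg_left (hadd v w) hc
    simp only [q, dotProduct_add]
    linarith
  have hqsmul : ∀ a : ℝ, 0 ≤ a → ∀ v, q (a • v) = a * q v := fun a ha v => by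
    simp only [q, hsmul, dotProduct_smul, smul_eq_mul, abs_of_nonneg ha]
    ring
  have hjj : 0 < realVec j ⬝ᵥ realVec j := realVec_dot_self_pos hj0
  set n : Fin N → ℝ := (realVec j ⬝ᵥ realVec j)⁻¹ • realVec j with hn
  have hjn : realVec j ⬝ᵥ n = 1 := by
    rw [hn, dotProduct_smul, smul_eq_mul, inv_mul_cancel₀ hjj.ne']
  have hcross : ∀ v w, realVec j ⬝ᵥ v = 1 → realVec j ⬝ᵥ w = -1 → -q w ≤ q v := by
    intro v w hv hw
    have := hq0 (v + w) (by rw [dotProduct_add, hv, hw]; ring)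
    linarith [hqadd v w]
  -- The infimum of `q` over `realVec j ⬝ᵥ v = 1` is the largest admissible slope; `hcross` bounds
  -- it below by every `-q w` with `realVec j ⬝ᵥ w = -1`, so it also works on the negative side.
  let S : Set ℝ := q '' {v | realVec j ⬝ᵥ v = 1}
  have hSne : S.Nonempty := ⟨q n, n, hjn, rfl⟩
  have hSbdd : BddBelow S := by
    refine ⟨-q (-n), ?_⟩
    rintro _ ⟨v, hv, rfl⟩
    exact hcross v (-n) hv (by rw [dotProduct_neg, hjn])
  have ht : ∀ v, sInf S * (realVec j ⬝ᵥ v) ≤ q v := by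
    intro v
    rcases lt_trichotomy (realVec j ⬝ᵥ v) 0 with hv | hv | hv
    · have h1 : -q ((-(realVec j ⬝ᵥ v))⁻¹ • v) ≤ sInf S := by
        refine le_csInf hSne ?_
        rintro _ ⟨w, hw, rfl⟩
        refine hcross w _ hw ?_
        rw [dotProduct_smul, smul_eq_mul, inv_neg, neg_mul, inv_mul_cancel₀ hv.ne]
      have hpos : 0 < -(realVec j ⬝ᵥ v) := by linarith
      rw [hqsmul _ (inv_nonneg.2 hpos.le), neg_le, inv_mul_eq_div, le_div_iff₀ hpos] at h1
      linarith
    · rw [hv, mul_zero]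
      exact hq0 v hv
    · have h1 : sInf S ≤ q ((realVec j ⬝ᵥ v)⁻¹ • v) := by
        refine csInf_le hSbdd ⟨_, ?_, rfl⟩
        change realVec j ⬝ᵥ _ = 1
        rw [dotProduct_smul, smul_eq_mul, inv_mul_cancel₀ hv.ne']
      rwa [hqsmul _ (inv_nonneg.2 hv.le), inv_mul_eq_div, le_div_iff₀ hv] at h1
  refine ⟨sInf S, fun s hs => (h.polar_le_iff hc).2 fun v => ?_⟩
  have h1 := ht v
  have h2 : s * (realVec j ⬝ᵥ v) ≤ c * β j * |realVec j ⬝ᵥ v| := by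
    refine (le_abs_self _).trans ?_
    rw [abs_mul]
    exact mul_le_mul_of_nonneg_right hs (abs_nonneg _)
  simp only [q] at h1
  rw [hsplit, add_dotProduct, smul_dotProduct, smul_eq_mul]
  linarith

/-- The total interaction weight is controlled by the anisotropy alone. -/
lemma sum_mul_norm_eq (e : Fin m → Fin N → ℤ) (β : (Fin N → ℤ) → ℝ) :
    ∑ k ∈ directions e, β k * ∑ a, |realVec k a| = ∑ a, anisotropy e β (Pi.single a 1) := by
  simp only [anisotropy_eq, dotProduct_single, mul_one, Finset.mul_sum]
  exact Finset.sum_comm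

end Anisotropy


/-! ### Directions determined by the anisotropy. -/

section Parallel

variable {N m m' : ℕ} {e : Fin m → Fin N → ℤ} {β : (Fin N → ℤ) → ℝ}
  {e' : Fin m' → Fin N → ℤ} {β' : (Fin N → ℤ) → ℝ}

/-- If the hyperplane orthogonal to `k` is contained in the one orthogonal to `j ≠ 0`, then `k`
and `j` are parallel. -/
lemma exists_eq_smul_of_orthogonal {k j : Fin N → ℝ} (hj : j ≠ 0)
    (hkj : ∀ v, k ⬝ᵥ v = 0 → j ⬝ᵥ v = 0) : ∃ q : ℝ, k = q • j := by
  have hjj : j ⬝ᵥ j ≠ 0 := fun h => hj (dotProduct_self_eq_zero.1 h)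
  by_cases hk : k ⬝ᵥ k = 0
  · exact ⟨0, by rw [dotProduct_self_eq_zero.1 hk, zero_smul]⟩
  · set c := (k ⬝ᵥ j) / (k ⬝ᵥ k) with hc
    have h1 : k ⬝ᵥ (j - c • k) = 0 := by
      rw [dotProduct_sub, dotProduct_smul, smul_eq_mul, hc, div_mul_cancel₀ _ hk, sub_self]
    have h2 := hkj _ h1
    have h3 : (j - c • k) ⬝ᵥ (j - c • k) = 0 := by
      rw [sub_dotProduct, smul_dotProduct, h1, h2, smul_zero, sub_zero]
    have h4 : j = c • k := sub_eq_zero.1 (dotProduct_self_eq_zero.1 h3)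
    have hc0 : c ≠ 0 := by
      rintro h0
      exact hj (by rw [h4, h0, zero_smul])
    exact ⟨c⁻¹, by rw [h4, smul_smul, inv_mul_cancel₀ hc0, one_smul]⟩

/-- The lines spanned by the interaction directions are determined by the anisotropy. -/
lemma IsInteraction.exists_parallel (h' : IsInteraction e' β')
    (heq : anisotropy e β = anisotropy e' β') {k : Fin N → ℤ} (hk : k ∈ directions e') (hk0 : k ≠ 0) :
    ∃ j ∈ directions e, j ≠ 0 ∧ ∃ q : ℝ, 0 < q ∧ realVec k = q • realVec j := by
  suffices hpar : ∃ j ∈ directions e, j ≠ 0 ∧ ∃ q : ℝ, realVec k = q • realVec j by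
    obtain ⟨j, hj, hj0, q, hq⟩ := hpar
    rcases lt_trichotomy q 0 with hq0 | hq0 | hq0
    · exact ⟨-j, neg_mem_directions hj, neg_ne_zero.2 hj0, -q, by linarith,
        by rw [realVec_neg, smul_neg, neg_smul, neg_neg, hq]⟩
    · rw [hq0, zero_smul] at hq
      exact absurd hq (realVec_ne_zero hk0)
    · exact ⟨j, hj, hj0, q, hq0, hq⟩
  by_contra! hcon
  let dot : (Fin N → ℝ) → Module.Dual ℝ (Fin N → ℝ) := fun w => dotProductBilin ℝ ℝ w
  let J := {j : Fin N → ℤ // j ∈ directions e ∧ j ≠ 0}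
  have : Finite J := Finite.of_injective (fun j : J => (⟨j.1, j.2.1⟩ : directions e))
    fun a b hab => Subtype.ext (by simpa using hab)
  -- A real vector space is not a finite union of proper subspaces, so some `v` orthogonal to `k`
  -- avoids all hyperplanes orthogonal to the nonzero directions of `e`. Near `v`, along `k`, the
  -- first expression of the anisotropy is affine (`h1`), while the term of index `k` gives the
  -- second one a kink (`h2`).
  obtain ⟨v, hv, hvj⟩ := Module.Dual.exists_forall_mem_ne_zero_of_forall_exists
    (LinearMap.ker (dot (realVec k))) (fun j : J => dot (realVec j.1)) (by
      intro j
      by_contra! hall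
      obtain ⟨q, hq⟩ := exists_eq_smul_of_orthogonal (k := realVec k)
        (realVec_ne_zero j.2.2) (fun v hv => hall v (by simpa [dot] using hv))
      exact hcon j.1 j.2.1 j.2.2 q hq)
  have hv : realVec k ⬝ᵥ v = 0 := by simpa [dot] using hv
  have hvj : ∀ j ∈ directions e, j ≠ 0 → realVec j ⬝ᵥ v ≠ 0 := fun j hj hj0 => hvj ⟨j, hj, hj0⟩
  have htend : ∀ᶠ t : ℝ in nhdsWithin 0 (Set.Ioi 0), ∀ j ∈ directions e,
      |t * (realVec j ⬝ᵥ realVec k)| ≤ |realVec j ⬝ᵥ v| := by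
    rw [Filter.eventually_all_finset]
    intro j hj
    by_cases hj0 : j = 0
    · subst hj0
      have hz : realVec (0 : Fin N → ℤ) = 0 := by ext; simp [realVec]
      simp [hz]
    · have hcont : Filter.Tendsto (fun t : ℝ => |t * (realVec j ⬝ᵥ realVec k)|)
          (nhdsWithin 0 (Set.Ioi 0)) (nhds 0) := by
        refine Filter.Tendsto.mono_left ?_ nhdsWithin_le_nhds
        have : Continuous fun t : ℝ => |t * (realVec j ⬝ᵥ realVec k)| := by fun_prop
        simpa using this.tendsto 0
      exact (hcont.eventually_lt_const (abs_pos.2 (hvj j hj hj0))).mono fun t ht => ht.le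
  obtain ⟨t, ht, ht0⟩ := (htend.and self_mem_nhdsWithin).exists
  have ht0 : 0 < t := ht0
  have h1 : anisotropy e β (v + t • realVec k) + anisotropy e β (v - t • realVec k)
      = 2 * anisotropy e β v := by
    simp only [anisotropy_eq, ← Finset.sum_add_distrib, Finset.mul_sum]
    refine Finset.sum_congr rfl fun j hj => ?_
    have := ht j hj
    rw [dotProduct_add, dotProduct_sub, dotProduct_smul, smul_eq_mul]
    generalize t * (realVec j ⬝ᵥ realVec k) = y at this ⊢
    generalize realVec j ⬝ᵥ v = x at this ⊢
    have habs : |x + y| + |x - y| = 2 * |x| := by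
      rw [abs_le] at this
      rcases abs_cases x with ⟨hx, hx'⟩ | ⟨hx, hx'⟩ <;> rw [hx] at this ⊢
      · rw [abs_of_nonneg (by linarith), abs_of_nonneg (by linarith)]; ring
      · rw [abs_of_nonpos (by linarith), abs_of_nonpos (by linarith)]; ring
    rw [← mul_add, habs]; ring
  have h2 : 2 * anisotropy e' β' v
      < anisotropy e' β' (v + t • realVec k) + anisotropy e' β' (v - t • realVec k) := by
    simp only [anisotropy_eq, ← Finset.sum_add_distrib, Finset.mul_sum]
    refine Finset.sum_lt_sum (fun j _ => ?_) ⟨k, hk, ?_⟩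
    · rw [← mul_add, mul_left_comm, dotProduct_add, dotProduct_sub]
      refine mul_le_mul_of_nonneg_left ?_ (h'.nonneg j)
      have := abs_add_le (realVec j ⬝ᵥ v + realVec j ⬝ᵥ t • realVec k)
        (realVec j ⬝ᵥ v - realVec j ⬝ᵥ t • realVec k)
      rwa [add_add_sub_cancel, ← two_mul, abs_mul, abs_two] at this
    · have hp := (h'.pos_iff k).2 hk
      have hkk := realVec_dot_self_pos hk0
      rw [dotProduct_add, dotProduct_sub, hv, dotProduct_smul, smul_eq_mul, zero_add, zero_sub,
        abs_neg, abs_zero, abs_of_pos (mul_pos ht0 hkk)]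
      have := mul_pos hp (mul_pos ht0 hkk)
      linarith
  rw [← heq] at h2
  linarith

end Parallel

/-! ### One-dimensional calibrating fluxes on lattice lines. -/

section Flux

/-- A coercive function on `ℤ^N` that is quasiconvex along the lines of direction `k` admits a
flux along these lines that calibrates it, and whose increment at a point of the plateau of
minimizers `i + [a, b] k` is inversely proportional to the number of points of the plateau. -/
lemma exists_flux {N : ℕ} {f : (Fin N → ℤ) → ℝ} {k : Fin N → ℤ} (hk : k ≠ 0)
    (hq : ∀ (i : Fin N → ℤ) (n p l : ℤ), n ≤ p → p ≤ l →
      f (i + p • k) ≤ max (f (i + n • k)) (f (i + l • k)))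
    (hfin : ∀ c, {i | f i ≤ c}.Finite) :
    ∃ s : (Fin N → ℤ) → ℝ, (∀ i, |s i| ≤ 1) ∧ (∀ i, f i < f (i + k) → s i = 1) ∧
      (∀ i, f (i + k) < f i → s i = -1) ∧
      ∀ i, s i - s (i - k) ≤ 0 ∨ ∃ a b : ℤ, a ≤ 0 ∧ 0 ≤ b ∧ f i < f (i + (a - 1) • k) ∧
        f i < f (i + (b + 1) • k) ∧ s i - s (i - k) ≤ 2 / ((b - a + 1 : ℤ) : ℝ) := by
  have hinj : ∀ i : Fin N → ℤ, Function.Injective fun n : ℤ => i + n • k := fun i n p hnp =>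
    smul_left_injective ℤ hk (add_left_cancel hnp)
  have hplateau : ∀ i, ∃ a b : ℤ, a ≤ b ∧
      ∀ n : ℤ, (∀ p : ℤ, f (i + n • k) ≤ f (i + p • k)) ↔ a ≤ n ∧ n ≤ b := by
    intro i
    have hlow : ∀ c, {n : ℤ | f (i + n • k) ≤ c}.Finite := fun c =>
      (hfin c).preimage (hinj i).injOn
    obtain ⟨n₀, -, hn₀⟩ := Set.exists_min_image _ (fun n : ℤ => f (i + n • k))
      (hlow (f (i + (0 : ℤ) • k))) ⟨0, le_refl (f _)⟩
    have hmin : ∀ p : ℤ, f (i + n₀ • k) ≤ f (i + p • k) := fun p => by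
      by_cases hp : f (i + p • k) ≤ f (i + (0 : ℤ) • k)
      · exact hn₀ p hp
      · exact (hn₀ 0 (le_refl (f _))).trans (not_le.1 hp).le
    obtain ⟨a, ha, ha'⟩ := Set.exists_min_image _ (fun n : ℤ => n) (hlow (f (i + n₀ • k)))
      ⟨n₀, le_refl (f _)⟩
    obtain ⟨b, hb, hb'⟩ := Set.exists_max_image _ (fun n : ℤ => n) (hlow (f (i + n₀ • k)))
      ⟨n₀, le_refl (f _)⟩
    refine ⟨a, b, ha' b hb, fun n => ⟨fun hn => ⟨ha' n (hn n₀), hb' n (hn n₀)⟩, ?_⟩⟩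
    rintro ⟨han, hnb⟩ p
    exact ((hq i a n b han hnb).trans (max_le ha hb)).trans (hmin p)
  -- Positions are relative to `i`, which sits at `0`: the minimizers of `f` on the line through `i`
  -- are the points of positions `a i, …, b i`.
  choose a b hab hmem using hplateau
  have hshift : ∀ i, a (i - k) = a i + 1 ∧ b (i - k) = b i + 1 := by
    intro i
    have hiff : ∀ n, (a (i - k) ≤ n + 1 ∧ n + 1 ≤ b (i - k)) ↔ a i ≤ n ∧ n ≤ b i := by
      intro n
      rw [← hmem, ← hmem]
      have hpt : ∀ p : ℤ, i - k + p • k = i + (p - 1) • k := fun p => by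
        rw [sub_smul, one_smul]; abel
      simp only [hpt, add_sub_cancel_right]
      refine ⟨fun hn p => ?_, fun hn p => hn _⟩
      simpa using hn (p + 1)
    have h1 := (hiff (a i)).2 ⟨le_rfl, hab i⟩
    have h2 := (hiff (b i)).2 ⟨hab i, le_rfl⟩
    have h3 := (hiff (a (i - k) - 1)).1 ⟨by omega, by linarith [hab (i - k)]⟩
    have h4 := (hiff (b (i - k) - 1)).1 ⟨by linarith [hab (i - k)], by omega⟩
    omega
  -- Linear interpolation in the rank `l` within the plateau: `-1` at rank `0`, `1` at the last rank
  -- `b i - a i + 1`. The flux at `i` lives on the edge from `i` to `i + k` and uses the rank `1 - a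
  -- i`, counted from `1`, so that the edge entering the plateau carries `-1` and the edge leaving
  -- it carries `1`.
  let pos : ℤ → (Fin N → ℤ) → ℝ := fun l i => -1 + 2 * (l : ℝ) / ((b i - a i + 1 : ℤ) : ℝ)
  have hMpos : ∀ i, (0 : ℝ) < ((b i - a i + 1 : ℤ) : ℝ) := fun i => by
    exact_mod_cast (by linarith [hab i] : (0 : ℤ) < b i - a i + 1)
  have hpos_low : ∀ l i, l ≤ 0 → pos l i ≤ -1 := fun l i hl => by
    have : 2 * (l : ℝ) / ((b i - a i + 1 : ℤ) : ℝ) ≤ 0 := by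
      refine div_nonpos_of_nonpos_of_nonneg ?_ (hMpos i).le
      have : (l : ℝ) ≤ 0 := by exact_mod_cast hl
      linarith
    simp only [pos]; linarith
  have hpos_high : ∀ l i, b i - a i + 1 ≤ l → 1 ≤ pos l i := fun l i hl => by
    have : 2 ≤ 2 * (l : ℝ) / ((b i - a i + 1 : ℤ) : ℝ) := by
      rw [le_div_iff₀ (hMpos i)]
      have : ((b i - a i + 1 : ℤ) : ℝ) ≤ l := by exact_mod_cast hl
      linarith
    simp only [pos]; linarith
  let clamp : ℝ → ℝ := fun t => max (-1) (min 1 t)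
  have clamp_low : ∀ t, t ≤ -1 → clamp t = -1 := fun t ht =>
    max_eq_left ((min_le_right _ _).trans ht)
  have clamp_high : ∀ t, 1 ≤ t → clamp t = 1 := fun t ht => by
    simp only [clamp, min_eq_left ht]
    norm_num
  have hprev : ∀ i, clamp (pos (1 - a (i - k)) (i - k)) = clamp (pos (-a i) i) := fun i => by
    obtain ⟨h1, h2⟩ := hshift i
    simp only [pos, h1, h2]
    ring_nf
  refine ⟨fun i => clamp (pos (1 - a i) i), fun i => ?_, fun i hi => ?_, fun i hi => ?_,
    fun i => ?_⟩
  · exact abs_le.2 ⟨le_max_left _ _, max_le (by norm_num) (min_le_left _ _)⟩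
  · refine clamp_high _ (hpos_high _ _ ?_)
    have : ¬ 1 ≤ b i := fun h1 => by
      have hb := (hmem i (b i)).2 ⟨hab i, le_rfl⟩ 0
      have := (hq i 0 1 (b i) zero_le_one h1).trans (max_le le_rfl hb)
      simp only [zero_smul, one_smul, add_zero] at this
      linarith
    omega
  · refine clamp_low _ (hpos_low _ _ ?_)
    have : ¬ a i ≤ 0 := fun h1 => by
      have ha := (hmem i (a i)).2 ⟨le_rfl, hab i⟩ 1
      have := (hq i (a i) 0 1 h1 zero_le_one).trans (max_le ha le_rfl)
      simp only [zero_smul, one_smul, add_zero] at this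
      linarith
    omega
  · simp only [hprev]
    by_cases ha : a i ≤ 0
    · by_cases hb : 0 ≤ b i
      · right
        have hi := (hmem i 0).2 ⟨ha, hb⟩
        simp only [zero_smul, add_zero] at hi
        have hout : ∀ n, ¬ (a i ≤ n ∧ n ≤ b i) → f i < f (i + n • k) := fun n hn => by
          rw [← hmem] at hn
          push Not at hn
          obtain ⟨p, hp⟩ := hn
          exact (hi p).trans_lt hp
        refine ⟨a i, b i, ha, hb, hout _ (by omega), hout _ (by omega), ?_⟩
        have hle : pos (1 - a i) i = pos (-a i) i + 2 / ((b i - a i + 1 : ℤ) : ℝ) := by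
          simp only [pos]
          push_cast
          ring
        have hd : (0 : ℝ) < 2 / ((b i - a i + 1 : ℤ) : ℝ) := div_pos two_pos (hMpos i)
        rw [hle]
        generalize 2 / ((b i - a i + 1 : ℤ) : ℝ) = d at hd ⊢
        generalize pos (-a i) i = y
        simp only [clamp]
        have h1 : max (-1) (min 1 (y + d)) ≤ max (-1) (min 1 y) + d := by
          refine max_le ?_ ?_
          · linarith [le_max_left (-1) (min 1 y)]
          · refine le_trans ?_ (add_le_add_left (le_max_right (-1) (min 1 y)) d)
            rcases min_cases 1 y with ⟨h, _⟩ | ⟨h, _⟩ <;> rw [h]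
            · linarith [min_le_left 1 (y + d)]
            · exact min_le_right _ _
        linarith
      · left
        rw [clamp_high _ (hpos_high (1 - a i) i (by omega)),
          clamp_high _ (hpos_high (-a i) i (by omega)), sub_self]
    · left
      rw [clamp_low _ (hpos_low (1 - a i) i (by omega)),
        clamp_low _ (hpos_low (-a i) i (by omega)), sub_self]

end Flux

/-! ### Comparison principle for calibrated fields. -/

section Comparison

variable {N : ℕ}

/-- Summing the divergence of an antisymmetrized field over a finite set only leaves the flux
through its boundary. -/
lemma sum_divAdjoint_nonneg {ε : ℝ} (hε : 0 < ε) {D : Finset (Fin N → ℤ)}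
    (hD : ∀ k ∈ D, -k ∈ D) {ζ : (Fin N → ℤ) → (Fin N → ℤ) → ℝ}
    (hsupp : ∀ i j, i - j ∉ D → ζ i j = 0) (E : Finset (Fin N → ℤ))
    (hout : ∀ i ∈ E, ∀ j ∉ E, 0 ≤ ζ i j - ζ j i) :
    0 ≤ ∑ i ∈ E, divAdjoint ε ζ i := by
  classical
  -- All points interacting with `E`. The sum over pairs inside `E` cancels by antisymmetry.
  let T : Finset (Fin N → ℤ) := E ∪ (E ×ˢ D).image fun p => p.1 + p.2
  have hdiv : ∀ i ∈ E, divAdjoint ε ζ i = ∑ j ∈ T, (ζ i j - ζ j i) / ε := by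
    intro i hi
    refine tsum_eq_sum fun j hj => ?_
    have hji : j - i ∉ D := fun hmem => hj <| Finset.mem_union_right _ <|
      Finset.mem_image.2 ⟨(i, j - i), Finset.mem_product.2 ⟨hi, hmem⟩, by simp⟩
    have hij : i - j ∉ D := fun hmem => hji (by simpa using hD _ hmem)
    rw [hsupp i j hij, hsupp j i hji, sub_self, zero_div]
  rw [Finset.sum_congr rfl hdiv]
  have hET : E ⊆ T := Finset.subset_union_left
  have hsplit : ∑ i ∈ E, ∑ j ∈ T, (ζ i j - ζ j i) / ε
      = ∑ i ∈ E, ∑ j ∈ E, (ζ i j - ζ j i) / ε + ∑ i ∈ E, ∑ j ∈ T \ E, (ζ i j - ζ j i) / ε := by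
    rw [← Finset.sum_add_distrib]
    refine Finset.sum_congr rfl fun i _ => ?_
    rw [add_comm, Finset.sum_sdiff hET]
  have hzero : ∑ i ∈ E, ∑ j ∈ E, (ζ i j - ζ j i) / ε = 0 := by
    simp only [sub_div, Finset.sum_sub_distrib]
    rw [sub_eq_zero]
    exact Finset.sum_comm
  rw [hsplit, hzero, zero_add]
  exact Finset.sum_nonneg fun i hi => Finset.sum_nonneg fun j hj =>
    div_nonneg (hout i hi j (Finset.mem_sdiff.1 hj).2) hε.le

lemma divAdjoint_eq_sum {D : Finset (Fin N → ℤ)} (hD : ∀ k ∈ D, -k ∈ D) (ε : ℝ)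
    {z : (Fin N → ℤ) → (Fin N → ℤ) → ℝ} (hsupp : ∀ i j, i - j ∉ D → z i j = 0)
    (i : Fin N → ℤ) :
    divAdjoint ε z i = ∑ k ∈ D, (z i (i + k) - z (i + k) i) / ε := by
  rw [divAdjoint, ← (Equiv.addLeft i).tsum_eq]
  simp only [Equiv.coe_addLeft]
  refine tsum_eq_sum fun k hk => ?_
  rw [hsupp i (i + k) fun h => hk (by simpa using hD _ h),
    hsupp (i + k) i (by simpa using hk), sub_self, zero_div]

/-- Both `z` and `Z` are subgradients of `b * |·|`, and the subdifferential of a convex function is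
monotone. -/
lemma monotone_calibration {u U z Z b : ℝ} (hz : z * u = b * |u|) (hzb : |z| ≤ b)
    (hZ : Z * U = b * |U|) (hZb : |Z| ≤ b) (h : U < u) : Z ≤ z := by
  rcases lt_or_ge 0 u with hu | hu
  · rw [abs_of_pos hu] at hz
    rw [mul_right_cancel₀ hu.ne' hz]
    exact (le_abs_self Z).trans hZb
  · have hU : U < 0 := h.trans_le hu
    rw [abs_of_neg hU, mul_neg, ← neg_mul] at hZ
    rw [mul_right_cancel₀ hU.ne hZ]
    exact (abs_le.1 hzb).1

/-- Comparison principle: a calibrated strict supersolution lies above every solution as soon as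
the set where it could fail to do so is finite. -/
lemma IsSolution.le_of_supersolution {β : (Fin N → ℤ) → ℝ} {ε h : ℝ} (hε : 0 < ε) (hh : 0 < h)
    {D : Finset (Fin N → ℤ)} (hD : ∀ k ∈ D, -k ∈ D) (hβD : ∀ k ∉ D, β k = 0)
    {g u U : (Fin N → ℤ) → ℝ} {z Z : (Fin N → ℤ) → (Fin N → ℤ) → ℝ}
    (hu : IsSolution β ε h g u z)
    (hZ : ∀ i j, Z i j * (U i - U j) = β (i - j) * |U i - U j|)
    (hZb : ∀ i j, |Z i j| ≤ β (i - j))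
    (hsuper : ∀ i, g i ≤ h * divAdjoint ε Z i + U i)
    (hfin : {i | U i < u i}.Finite) (i : Fin N → ℤ) : u i ≤ U i := by
  have hsz : ∀ (w : (Fin N → ℤ) → (Fin N → ℤ) → ℝ), (∀ i j, |w i j| ≤ β (i - j)) →
      ∀ i j, i - j ∉ D → w i j = 0 := fun w hw i j hij => by
    have := hw i j
    rw [hβD _ hij] at this
    exact abs_eq_zero.1 (le_antisymm this (abs_nonneg _))
  have hsub : ∀ i, divAdjoint ε (fun i j => z i j - Z i j) i
      = divAdjoint ε z i - divAdjoint ε Z i := fun i => by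
    rw [divAdjoint_eq_sum hD ε (hsz z hu.bound), divAdjoint_eq_sum hD ε (hsz Z hZb),
      divAdjoint_eq_sum hD ε (z := fun i j => z i j - Z i j)
        (fun i j hij => by rw [hsz z hu.bound i j hij, hsz Z hZb i j hij, sub_zero]),
      ← Finset.sum_sub_distrib]
    exact Finset.sum_congr rfl fun k _ => by ring
  by_contra! hlt
  let E := hfin.toFinset
  have hE : ∀ j, j ∈ E ↔ U j < u j := fun j => by simp [E]
  -- On the set `E` where `u` exceeds `U`, the difference `u - U` drops across the boundary, so
  -- monotonicity makes the outward flux of `z - Z` nonnegative; the equation and the supersolution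
  -- inequality make the same sum negative.
  have hflux : 0 ≤ ∑ i ∈ E, divAdjoint ε (fun i j => z i j - Z i j) i := by
    refine sum_divAdjoint_nonneg hε hD
      (fun i j hij => by rw [hsz z hu.bound i j hij, hsz Z hZb i j hij, sub_zero]) E ?_
    intro i hi j hj
    rw [hE] at hi hj
    have h1 := monotone_calibration (hu.calibrates i j) (hu.bound i j) (hZ i j) (hZb i j)
      (by linarith)
    have h2 := monotone_calibration (hZ j i) (hZb j i) (hu.calibrates j i) (hu.bound j i)
      (by linarith)
    linarith
  have hneg : ∑ i ∈ E, h * divAdjoint ε (fun i j => z i j - Z i j) i < 0 := by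
    refine Finset.sum_neg (fun j hj => ?_) ⟨i, (hE i).2 hlt⟩
    rw [hE] at hj
    rw [hsub]
    have h1 := hu.equation j
    have h2 := hsuper j
    nlinarith
  rw [← Finset.mul_sum] at hneg
  exact absurd (mul_nonneg hh.le hflux) (not_le.2 hneg)

end Comparison


/-! ### Calibration of the truncated polar norm and construction of the barrier. -/

section Barrier

variable {N m m' : ℕ} {e : Fin m → Fin N → ℤ} {β : (Fin N → ℤ) → ℝ}
  {e' : Fin m' → Fin N → ℤ} {β' : (Fin N → ℤ) → ℝ}

/-- The polar norm on the lattice, truncated from below at level `R`. -/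
noncomputable def truncatedPolar (φ : (Fin N → ℝ) → ℝ) (ε R : ℝ) (i : Fin N → ℤ) : ℝ :=
  max (polar φ (latticePoint ε i)) R

lemma latticePoint_add_smul (ε : ℝ) (i k : Fin N → ℤ) (n : ℤ) :
    latticePoint ε (i + n • k) = latticePoint ε i + (n * ε) • realVec k := by
  ext a
  simp [latticePoint, realVec]
  ring

lemma IsInteraction.truncatedPolar_line_le (h : IsInteraction e β) (ε : ℝ) {R : ℝ} (hε : 0 < ε)
    (hR : 0 < R) (k i : Fin N → ℤ) {n p l : ℤ} (hnp : n ≤ p) (hpl : p ≤ l) :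
    truncatedPolar (anisotropy e β) ε R (i + p • k) ≤
      max (truncatedPolar (anisotropy e β) ε R (i + n • k))
        (truncatedPolar (anisotropy e β) ε R (i + l • k)) := by
  set c := max (truncatedPolar (anisotropy e β) ε R (i + n • k))
    (truncatedPolar (anisotropy e β) ε R (i + l • k)) with hc
  have hRc : R ≤ c := (le_max_right _ _).trans (le_max_left _ _)
  refine max_le ?_ hRc
  have hn : polar (anisotropy e β) (latticePoint ε (i + n • k)) ≤ c :=
    (le_max_left _ R).trans (le_max_left _ _)
  have hl : polar (anisotropy e β) (latticePoint ε (i + l • k)) ≤ c :=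
    (le_max_left _ R).trans (le_max_right _ _)
  rw [latticePoint_add_smul] at hn hl ⊢
  exact h.polar_line_le (hR.le.trans hRc) hn hl
    (mul_le_mul_of_nonneg_right (by exact_mod_cast hnp) hε.le)
    (mul_le_mul_of_nonneg_right (by exact_mod_cast hpl) hε.le)

/-- A nonzero integer vector has a coordinate of modulus at least `1`. This removes the unknown
ratio `q` between parallel directions from the estimates. -/
lemma le_sum_abs_of_eq_smul {k j : Fin N → ℤ} (hj : j ≠ 0) {q : ℝ} (hq : 0 < q)
    (hkj : realVec k = q • realVec j) : q ≤ ∑ a, |realVec k a| := by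
  obtain ⟨a, ha⟩ := Function.ne_iff.1 hj
  have h1 : (1 : ℝ) ≤ |realVec j a| := by
    have : (1 : ℤ) ≤ |j a| := Int.one_le_abs ha
    rw [realVec, ← Int.cast_abs]
    exact_mod_cast this
  have h2 : q ≤ |realVec k a| := by
    rw [hkj, Pi.smul_apply, smul_eq_mul, abs_mul, abs_of_pos hq]
    exact le_mul_of_one_le_right hq.le h1
  exact h2.trans (Finset.single_le_sum (f := fun a => |realVec k a|)
    (fun a _ => abs_nonneg _) (Finset.mem_univ a))

/-- Flux of the truncated polar norm along the lines of direction `k`, with an increment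
controlled by the length of `k` and by constants depending on a reference interaction only. -/
lemma IsInteraction.exists_flux (h : IsInteraction e β) (h' : IsInteraction e' β')
    (heq : anisotropy e β = anisotropy e' β') {c : ℝ} (hc0 : 0 < c)
    (hc : ∀ j ∈ directions e, c ≤ β j) {ε R : ℝ} (hε : 0 < ε) (hR : 0 < R) (k : Fin N → ℤ) :
    ∃ s : (Fin N → ℤ) → ℝ, (∀ i, |s i| ≤ 1) ∧
      (∀ i, truncatedPolar (anisotropy e β) ε R i < truncatedPolar (anisotropy e β) ε R (i + k) →
        s i = 1) ∧
      (∀ i, truncatedPolar (anisotropy e β) ε R (i + k) < truncatedPolar (anisotropy e β) ε R i →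
        s i = -1) ∧
      (k ∈ directions e' → ∀ i, s i - s (i - k) ≤
        2 * ε * (∑ a, |realVec k a|) / (c * truncatedPolar (anisotropy e β) ε R i)) := by
  by_cases hk : k = 0
  · subst hk
    refine ⟨0, by simp, by simp, by simp, fun _ i => ?_⟩
    simp [realVec]
  set f := truncatedPolar (anisotropy e β) ε R with hf
  have hRf : ∀ i, R ≤ f i := fun i => le_max_right _ _
  obtain ⟨s, hs, hs1, hs2, hs3⟩ := DiscreteROF.exists_flux (f := f) hk
    (fun i n p l hnp hpl => h.truncatedPolar_line_le ε hε hR k i hnp hpl)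
    (fun b => (h.finite_sublevel hε b).subset fun i hi => (le_max_left _ R).trans hi)
  refine ⟨s, hs, hs1, hs2, fun hkD i => ?_⟩
  have hfi : 0 < f i := hR.trans_le (hRf i)
  have hsum : 0 ≤ ∑ a, |realVec k a| := Finset.sum_nonneg fun a _ => abs_nonneg _
  rcases hs3 i with h0 | ⟨a, b, ha, hb, hfa, hfb, hsi⟩
  · exact h0.trans (by positivity)
  obtain ⟨j, hj, hj0, q, hq, hkj⟩ := h'.exists_parallel heq hkD hk
  have hqk := le_sum_abs_of_eq_smul hj0 hq hkj
  have hx : polar (anisotropy e β) (latticePoint ε i) ≤ f i := le_max_left _ _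
  obtain ⟨t, ht⟩ := h.exists_section hj hj0 hfi.le hx
  have hx0 : polar (anisotropy e β) (latticePoint ε i + (0 : ℝ) • realVec j) ≤ f i := by
    rwa [zero_smul, add_zero]
  have hfar : ∀ n : ℤ, f i < f (i + n • k) →
      ¬ polar (anisotropy e β) (latticePoint ε i + (n * ε * q) • realVec j) ≤ f i := by
    intro n hn hle
    refine absurd hn (not_lt.2 (max_le ?_ (hRf i)))
    rwa [latticePoint_add_smul, hkj, smul_smul]
  have hβj : 0 < β j := hc0.trans_le (hc j hj)
  have hw : 0 < f i * β j := mul_pos hfi hβj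
  have hεq : 0 < ε * q := mul_pos hε hq
  have hright : t + f i * β j < ((b + 1 : ℤ) : ℝ) * ε * q := by
    by_contra! hcon
    refine hfar _ hfb (h.polar_line_le hfi.le hx0 (ht (f i * β j) (abs_of_pos hw).le) ?_ hcon)
    have : (0 : ℝ) ≤ ((b + 1 : ℤ) : ℝ) := by exact_mod_cast (by omega : (0 : ℤ) ≤ b + 1)
    positivity
  have hleft : ((a - 1 : ℤ) : ℝ) * ε * q < t + -(f i * β j) := by
    by_contra! hcon
    refine hfar _ hfa (h.polar_line_le hfi.le
      (ht (-(f i * β j)) (by rw [abs_neg, abs_of_pos hw])) hx0 hcon ?_)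
    have : ((a - 1 : ℤ) : ℝ) ≤ 0 := by exact_mod_cast (by omega : a - 1 ≤ 0)
    rw [mul_assoc]
    exact mul_nonpos_of_nonpos_of_nonneg this hεq.le
  have hM : (1 : ℝ) ≤ ((b - a + 1 : ℤ) : ℝ) := by exact_mod_cast (by omega : 1 ≤ b - a + 1)
  -- The segment of half-length `f i * β j` fits strictly between the positions `a - 1` and `b + 1`,
  -- whose distance is `b - a + 2`; this is at most twice `b - a + 1`, which absorbs the factor `2`.
  have hcount : c * f i ≤ ((b - a + 1 : ℤ) : ℝ) * (ε * q) := by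
    have h1 : f i * c ≤ f i * β j := mul_le_mul_of_nonneg_left (hc j hj) hfi.le
    push_cast at hright hleft hM ⊢
    nlinarith
  refine hsi.trans ?_
  rw [div_le_div_iff₀ (by linarith) (by positivity)]
  have h1 : ((b - a + 1 : ℤ) : ℝ) * (ε * q) ≤ ((b - a + 1 : ℤ) : ℝ) * (ε * ∑ a, |realVec k a|) :=
    mul_le_mul_of_nonneg_left (mul_le_mul_of_nonneg_left hqk hε.le) (by linarith)
  linarith

/-- A field calibrating the truncated polar norm, with divergence bounded by the inverse of the
distance to the origin. -/
lemma IsInteraction.exists_calibration (h : IsInteraction e β) (h' : IsInteraction e' β')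
    (heq : anisotropy e β = anisotropy e' β') {c : ℝ} (hc0 : 0 < c)
    (hc : ∀ j ∈ directions e, c ≤ β j) {ε R : ℝ} (hε : 0 < ε) (hR : 0 < R) :
    ∃ Z : (Fin N → ℤ) → (Fin N → ℤ) → ℝ, (∀ i j, |Z i j| ≤ β' (i - j)) ∧
      (∀ i j, truncatedPolar (anisotropy e β) ε R i < truncatedPolar (anisotropy e β) ε R j →
        Z i j = -β' (i - j)) ∧
      (∀ i j, truncatedPolar (anisotropy e β) ε R j < truncatedPolar (anisotropy e β) ε R i →
        Z i j = β' (i - j)) ∧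
      ∀ i, -(2 * (∑ a, anisotropy e β (Pi.single a 1)) / c
        / truncatedPolar (anisotropy e β) ε R i) ≤ divAdjoint ε Z i := by
  choose s hs hs1 hs2 hs3 using fun k => h.exists_flux h' heq hc0 hc hε hR k
  have hbound : ∀ i j, |-(β' (i - j) * s (j - i) i)| ≤ β' (i - j) := fun i j => by
    rw [abs_neg, abs_mul, abs_of_nonneg (h'.nonneg _)]
    exact mul_le_of_le_one_right (h'.nonneg _) (hs _ _)
  refine ⟨fun i j => -(β' (i - j) * s (j - i) i), hbound, fun i j hij => ?_, fun i j hij => ?_,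
    fun i => ?_⟩
  · beta_reduce
    rw [hs1 (j - i) i (by rwa [add_sub_cancel]), mul_one]
  · beta_reduce
    rw [hs2 (j - i) i (by rwa [add_sub_cancel]), mul_neg, mul_one, neg_neg]
  · set f := truncatedPolar (anisotropy e β) ε R with hf
    have hfi : 0 < f i := hR.trans_le (le_max_right _ _)
    have hD : ∀ k ∈ directions e', -k ∈ directions e' := fun k hk => neg_mem_directions hk
    rw [divAdjoint_eq_sum hD ε (fun i j hij => by rw [h'.eq_zero hij, zero_mul, neg_zero])]
    -- The reversed edges are brought back to direction `k` by `k ↦ -k`, so the divergence becomes a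
    -- sum of increments of the fluxes along lines.
    have hreindex : ∑ k ∈ directions e', β' k * s (-k) (i + k)
        = ∑ k ∈ directions e', β' k * s k (i - k) :=
      Finset.sum_nbij' (fun k => -k) (fun k => -k) hD hD (by simp) (by simp)
        fun k _ => by rw [h'.even, sub_neg_eq_add]
    have hrw : ∑ k ∈ directions e', (-(β' (i - (i + k)) * s (i + k - i) i)
          - -(β' (i + k - i) * s (i - (i + k)) (i + k))) / ε
        = -∑ k ∈ directions e', β' k * (s k i - s k (i - k)) / ε := by
      have hterm : ∀ k, (-(β' (i - (i + k)) * s (i + k - i) i)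
          - -(β' (i + k - i) * s (i - (i + k)) (i + k))) / ε
          = (β' k * s (-k) (i + k)) / ε - β' k * s k i / ε := fun k => by
        rw [sub_add_cancel_left, add_sub_cancel_left, h'.even]
        ring
      simp only [hterm, Finset.sum_sub_distrib, mul_sub, sub_div, ← Finset.sum_div, hreindex]
      ring
    rw [hrw, neg_le_neg_iff, heq, ← sum_mul_norm_eq, Finset.mul_sum, Finset.sum_div,
      Finset.sum_div]
    refine Finset.sum_le_sum fun k hk => ?_
    have := mul_le_mul_of_nonneg_left (hs3 k hk i) (h'.nonneg k)
    refine (div_le_div_of_nonneg_right this hε.le).trans (le_of_eq ?_)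
    field_simp

lemma add_div_lt_add_div {a b r t : ℝ} (ha : 1 < a) (hr : 0 < r) (hb : b ≤ r ^ 2) (hrt : r < t) :
    a * r + b / r < a * t + b / t := by
  have ht := hr.trans hrt
  have : b / r - b / t ≤ t - r := by
    rw [div_sub_div _ _ hr.ne' ht.ne', div_le_iff₀ (by positivity)]
    nlinarith [mul_pos hr (sub_pos.2 hrt), mul_pos hr ht]
  nlinarith

/-- The solution lies below `f + A h / f`, where `f` is the polar norm truncated at the level
`√(A h)`. -/
lemma IsInteraction.solution_le (h : IsInteraction e β) (h' : IsInteraction e' β')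
    (heq : anisotropy e β = anisotropy e' β') {c : ℝ} (hc0 : 0 < c)
    (hc : ∀ j ∈ directions e, c ≤ β j) {A : ℝ} (hA0 : 0 < A)
    (hA : 2 * (∑ a, anisotropy e β (Pi.single a 1)) / c ≤ A)
    {ε τ : ℝ} (hε : 0 < ε) (hτ : 0 < τ) {u : (Fin N → ℤ) → ℝ}
    {z : (Fin N → ℤ) → (Fin N → ℤ) → ℝ}
    (hu : IsSolution β' ε τ (fun i => polar (anisotropy e β) (latticePoint ε i)) u z)
    (i : Fin N → ℤ) :
    u i ≤ truncatedPolar (anisotropy e β) ε (√(A * τ)) i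
      + A * τ / truncatedPolar (anisotropy e β) ε (√(A * τ)) i := by
  have hR : 0 < √(A * τ) := Real.sqrt_pos.2 (mul_pos hA0 hτ)
  obtain ⟨Z, hZb, hZlt, hZgt, hZdiv⟩ := h.exists_calibration h' heq hc0 hc hε hR
  set f := truncatedPolar (anisotropy e β) ε (√(A * τ)) with hf
  have hRf : ∀ i, √(A * τ) ≤ f i := fun i => le_max_right _ _
  have hfpos : ∀ i, 0 < f i := fun i => hR.trans_le (hRf i)
  have hPf : ∀ i, polar (anisotropy e β) (latticePoint ε i) ≤ f i := fun i => le_max_left _ _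
  have hsq : ∀ i, A * τ ≤ f i ^ 2 := fun i => (Real.sqrt_le_left (hfpos i).le).1 (hRf i)
  have hD : ∀ k ∈ directions e', -k ∈ directions e' := fun k hk => neg_mem_directions hk
  -- The factor `1 + δ` makes the barrier outgrow `u`, which stays within a bounded distance above
  -- the datum; the contact set is then finite. Finally `δ` tends to `0` at the fixed point `i`.
  have hcompare : ∀ δ > 0, u i ≤ (1 + δ) * f i + A * τ / f i := by
    intro δ hδ
    have hmono : ∀ i j, f i < f j → (1 + δ) * f i + A * τ / f i < (1 + δ) * f j + A * τ / f j :=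
      fun i j hij => add_div_lt_add_div (by linarith) (hfpos i) (hsq i) hij
    refine hu.le_of_supersolution (U := fun i => (1 + δ) * f i + A * τ / f i) hε hτ hD
      (fun k hk => h'.eq_zero hk) (fun i j => ?_) hZb (fun i => ?_) ?_ i
    · rcases lt_trichotomy (f i) (f j) with hij | hij | hij
      · rw [hZlt i j hij, abs_of_neg (sub_neg.2 (hmono i j hij))]; ring
      · simp [hij]
      · rw [hZgt i j hij, abs_of_pos (sub_pos.2 (hmono j i hij))]
    · have h1 := mul_le_mul_of_nonneg_left (hZdiv i) hτ.le
      have h2 := mul_le_mul_of_nonneg_left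
        (div_le_div_of_nonneg_right hA (hfpos i).le) hτ.le
      have h3 : A * τ / f i = τ * (A / f i) := by ring
      have h4 := mul_pos hδ (hfpos i)
      have h5 := hPf i
      rw [h3]
      linarith
    · set B := τ * ∑ k ∈ directions e', 2 * β' k / ε with hB
      refine (h.finite_sublevel hε (B / δ)).subset fun i hi => ?_
      have h1 : -(∑ k ∈ directions e', 2 * β' k / ε) ≤ divAdjoint ε z i := by
        rw [divAdjoint_eq_sum hD ε (fun i j hij => abs_eq_zero.1 (le_antisymm
          ((hu.bound i j).trans (h'.eq_zero hij).le) (abs_nonneg _))), ← Finset.sum_neg_distrib]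
        refine Finset.sum_le_sum fun k _ => ?_
        rw [← neg_div]
        refine div_le_div_of_nonneg_right ?_ hε.le
        have h1 := abs_le.1 (hu.bound i (i + k))
        have h2 := abs_le.1 (hu.bound (i + k) i)
        rw [sub_add_cancel_left, h'.even] at h1
        rw [add_sub_cancel_left] at h2
        linarith [h1.1, h2.2]
      have h2 := mul_le_mul_of_nonneg_left h1 hτ.le
      have h3 := hu.equation i
      have h4 : (1 + δ) * f i + A * τ / f i < u i := hi
      have h5 : 0 < A * τ / f i := div_pos (mul_pos hA0 hτ) (hfpos i)
      have h6 := mul_le_mul_of_nonneg_left (hPf i) hδ.le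
      have h7 := hPf i
      change polar (anisotropy e β) (latticePoint ε i) ≤ B / δ
      rw [le_div_iff₀ hδ]
      rw [mul_neg, ← hB] at h2
      linarith
  refine le_of_forall_pos_le_add fun η hη => ?_
  have := hcompare (η / f i) (div_pos hη (hfpos i))
  rw [add_mul, one_mul, div_mul_cancel₀ _ (hfpos i).ne'] at this
  linarith

/-- Since `√A ≤ A + 1`, the truncation is inactive in the first case of the barrier. In the second,
`t + A τ / t` increases from the truncated value up to `t = (A + 1) μ`. -/
lemma truncatedPolar_add_div_le_barrier {φ : (Fin N → ℝ) → ℝ} {A ε τ : ℝ} (hA : 0 < A)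
    (hε : 0 < ε) (hτ : 0 < τ) (i : Fin N → ℤ) :
    truncatedPolar φ ε (√(A * τ)) i + A * τ / truncatedPolar φ ε (√(A * τ)) i
      ≤ barrier φ (A + 1) ε τ i := by
  set μ := max (√τ) ε with hμ
  have hμ0 : 0 < μ := hε.trans_le (le_max_right _ _)
  have hRμ : √(A * τ) ≤ (A + 1) * μ := by
    rw [Real.sqrt_mul hA.le]
    refine mul_le_mul ?_ (le_max_left _ _) (Real.sqrt_nonneg _) (by linarith)
    rw [Real.sqrt_le_left (by linarith)]
    nlinarith
  have hR : 0 < √(A * τ) := Real.sqrt_pos.2 (mul_pos hA hτ)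
  rw [barrier, ← hμ]
  split_ifs with hP
  · rw [truncatedPolar, max_eq_left (hRμ.trans hP)]
    have hpos := (hR.trans_le hRμ).trans_le hP
    have : A * τ / polar φ (latticePoint ε i) ≤ (A + 1) * τ / polar φ (latticePoint ε i) :=
      div_le_div_of_nonneg_right (by linarith) hpos.le
    linarith
  · set r := truncatedPolar φ ε (√(A * τ)) i with hr
    have hRr : √(A * τ) ≤ r := le_max_right _ _
    have hr0 : 0 < r := hR.trans_le hRr
    have hrμ : r ≤ (A + 1) * μ := max_le (not_le.1 hP).le hRμ
    have hsq : A * τ ≤ r ^ 2 := (Real.sqrt_le_left hr0.le).1 hRr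
    have hpos := hr0.trans_le hrμ
    have h1 : A * τ / r - A * τ / ((A + 1) * μ) ≤ (A + 1) * μ - r := by
      rw [div_sub_div _ _ hr0.ne' hpos.ne', div_le_iff₀ (by positivity)]
      nlinarith [mul_nonneg (sub_nonneg.2 hrμ)
        (sub_nonneg.2 (hsq.trans (by nlinarith : r ^ 2 ≤ r * ((A + 1) * μ))))]
    have h2 : A * τ / ((A + 1) * μ) ≤ (A + 1) * τ / μ := by
      have h3 := mul_pos hA hμ0
      exact div_le_div₀ (by positivity) (by linarith) hμ0 (by linarith)
    linarith

end Barrier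

end DiscreteROF

theorem lemma4p9 {N : ℕ} (φ : (Fin N → ℝ) → ℝ) :
    ∃ C : ℝ, 0 < C ∧
      ∀ (m : ℕ) (e : Fin m → Fin N → ℤ) (β : (Fin N → ℤ) → ℝ),
        DiscreteROF.IsInteraction e β →
        φ = DiscreteROF.anisotropy e β →
        ∀ ε h : ℝ, 0 < ε → 0 < h →
        ∀ (u : (Fin N → ℤ) → ℝ) (z : (Fin N → ℤ) → (Fin N → ℤ) → ℝ),
          DiscreteROF.IsSolution β ε h
            (fun i => DiscreteROF.polar φ (DiscreteROF.latticePoint ε i)) u z →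
          ∀ i, u i ≤ DiscreteROF.barrier φ C ε h i := by
  -- The constant is chosen before the interaction, so it is read off from one reference interaction
  -- for `φ`; if there is none, the claim is vacuous.
  by_cases hφ : ∃ (m : ℕ) (e : Fin m → Fin N → ℤ) (β : (Fin N → ℤ) → ℝ),
      DiscreteROF.IsInteraction e β ∧ φ = DiscreteROF.anisotropy e β
  · obtain ⟨m₀, e₀, β₀, h₀, rfl⟩ := hφ
    obtain ⟨c, hc0, hc⟩ : ∃ c : ℝ, 0 < c ∧ ∀ j ∈ DiscreteROF.directions e₀, c ≤ β₀ j := by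
      rcases (DiscreteROF.directions e₀).eq_empty_or_nonempty with hD | hD
      · exact ⟨1, one_pos, by simp [hD]⟩
      · obtain ⟨j, hj, hmin⟩ := Finset.exists_min_image _ β₀ hD
        exact ⟨β₀ j, (h₀.pos_iff j).2 hj, hmin⟩
    set K := 2 * (∑ a, DiscreteROF.anisotropy e₀ β₀ (Pi.single a 1)) / c with hK
    have hK0 : 0 ≤ K := div_nonneg (mul_nonneg zero_le_two
      (Finset.sum_nonneg fun a _ => h₀.anisotropy_nonneg _)) hc0.le
    -- One `+ 1` makes `A = K + 1` positive even when `K = 0`; the other comes from the passage to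
    -- `barrier φ (A + 1)`.
    refine ⟨K + 1 + 1, by linarith, fun m e β h heq ε τ hε hτ u z hu i => ?_⟩
    have hA : 0 < K + 1 := by linarith
    exact (h₀.solution_le h heq hc0 hc hA (by linarith) hε hτ hu i).trans
      (DiscreteROF.truncatedPolar_add_div_le_barrier hA hε hτ i)
  · exact ⟨1, one_pos, fun m e β h heq => absurd ⟨m, e, β, h, heq⟩ hφ⟩
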